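/- For an even integer $k\ge 4$ and $\tau$ in the upper half-plane $\mathbb{H}=\{\tau\in\mathbb{C}:\operatorname{Im}\tau>0\}$, let $$G_k(\tau)=\sum_{(a,b)\in\mathbb{Z}^2\setminus\{(0,0)\}}\frac{1}{(a\tau+b)^{k}}$$ be the Eisenstein series of weight $k$ (an absolutely convergent series). Then for every integer $n\ge 1$ we have, as functions on $\mathbb{H}$, $$\left\{\binom{6n+3}{2n+2}+2\binom{6n+3}{2n}\right\}G_{6n+4}=\sum_{k=1}^{n+1}\left[\binom{2n+2k-1}{2n}\binom{4n-2k+3}{2n}+2\binom{2n+2k-1}{2n}\binom{4n-2k+3}{2n+2}\right]G_{2n+2k}\,G_{4n-2k+4},$$ where $\binom{a}{b}=0$ for integers $0\le a<b$. -/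

import Mathlib

/-- The Eisenstein series `G_k(τ) = ∑_{(m,n) ∈ ℤ² ∖ {(0,0)}} (m τ + n)^{-k}` on the upper
half-plane. The sum converges absolutely for `k ≥ 3` (see `summable_eisensteinG`), so no order of
summation has to be fixed; it is used only for even `k ≥ 4`. -/
noncomputable def eisensteinG (k : ℕ) (τ : UpperHalfPlane) : ℂ :=
  ∑' v : {v : ℤ × ℤ // v ≠ (0, 0)}, ((v.1.1 : ℂ) * (τ : ℂ) + (v.1.2 : ℂ)) ^ (-(k : ℤ))

/-- The double series defining `eisensteinG k τ` converges (absolutely) when `k ≥ 3`. -/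
theorem summable_eisensteinG (k : ℕ) (hk : 3 ≤ k) (τ : UpperHalfPlane) :
    Summable fun v : {v : ℤ × ℤ // v ≠ (0, 0)} =>
      ((v.1.1 : ℂ) * (τ : ℂ) + (v.1.2 : ℂ)) ^ (-(k : ℤ)) := by
  have h := (EisensteinSeries.summable_norm_eisSummand (k := (k : ℤ)) (by exact_mod_cast hk) τ).of_norm
  have h2 := (((finTwoArrowEquiv ℤ).symm.summable_iff).mpr h).comp_injective
    (Subtype.val_injective (p := fun v : ℤ × ℤ => v ≠ (0, 0)))
  refine h2.congr fun v => ?_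
  simp [EisensteinSeries.eisSummand]

/-! The identity is a residue computation for `℘`, done with formal Laurent series at the origin.
The equation `℘'² = 4℘³ - g₂℘ - g₃` makes every odd derivative of `℘` equal to `℘'` times a
polynomial in `℘`. A product of three odd derivatives is therefore `℘'³ · R(℘) = ℘' · T(℘)`, which
is the derivative of a polynomial in `℘` and has residue zero
(`residue_derivative_iterate_mul_of_weierstrass`).

Up to a factorial, the derivative of odd order `m` is `F - z^{-(m+2)}`, where the coefficients of
the power series `F` are binomials times Eisenstein sums. For the orders `2n-1, 2n-1, 2n+1`, the
terms of the residue linear in the `F`s give the multiple of `G_{6n+4}`, and the quadratic terms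
give the convolution (`residue_sq_mul_eq`). -/

/-! ### Formal differentiation of Laurent series. -/

namespace LaurentSeries

open HahnSeries

variable {K : Type*} [Field K]

theorem derivative_coeff (f : LaurentSeries K) (n : ℤ) :
    (derivative K f).coeff n = ((n + 1 : ℤ) : K) * f.coeff (n + 1) := by
  rw [derivative_apply, hasseDeriv_coeff]
  simp

theorem coeff_single_one_mul_derivative (f : LaurentSeries K) (n : ℤ) :
    (single (1 : ℤ) (1 : K) * derivative K f).coeff n = (n : K) * f.coeff n := by
  rw [coeff_single_mul, derivative_coeff, one_mul, sub_add_cancel]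

theorem support_single_one_mul_derivative_subset (f : LaurentSeries K) :
    (single (1 : ℤ) (1 : K) * derivative K f).support ⊆ f.support := by
  intro n hn
  rw [mem_support, coeff_single_one_mul_derivative] at hn
  exact right_ne_zero_of_mul hn

/-- The Euler operator `X · d/dX` multiplies the `n`-th coefficient by `n` without shifting indices,
so for it the Leibniz rule is just `n = i + j` on each term of the convolution. Cancelling `X` gives
the rule for `d/dX`. -/
theorem derivative_mul (f g : LaurentSeries K) :
    derivative K (f * g) = f * derivative K g + g * derivative K f := by
  have hX : (single (1 : ℤ) (1 : K)) ≠ 0 := single_ne_zero one_ne_zero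
  refine mul_left_cancel₀ hX ?_
  have key : single (1 : ℤ) (1 : K) * derivative K (f * g) =
      f * (single (1 : ℤ) (1 : K) * derivative K g) +
        (single (1 : ℤ) (1 : K) * derivative K f) * g := by
    ext n
    rw [coeff_single_one_mul_derivative, coeff_add,
      coeff_mul_right' g.isPWO_support (support_single_one_mul_derivative_subset g),
      coeff_mul_left' f.isPWO_support (support_single_one_mul_derivative_subset f),
      coeff_mul, Finset.mul_sum, ← Finset.sum_add_distrib]
    refine Finset.sum_congr rfl fun ij hij => ?_
    have h : ij.1 + ij.2 = n := (Finset.mem_antidiagonal.mp hij).2.2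
    rw [coeff_single_one_mul_derivative, coeff_single_one_mul_derivative, ← h]
    push_cast
    ring
  rw [key]
  ring

theorem coeff_C_mul (c : K) (f : LaurentSeries K) (n : ℤ) :
    (HahnSeries.C c * f).coeff n = c * f.coeff n := by
  rw [C_apply, coeff_single_mul, sub_zero]

theorem derivative_C_mul (c : K) (f : LaurentSeries K) :
    derivative K (HahnSeries.C c * f) = HahnSeries.C c * derivative K f := by
  ext n
  simp only [derivative_coeff, coeff_C_mul]
  ring

theorem derivative_C (c : K) : derivative K (HahnSeries.C c) = 0 := by
  ext n
  rw [derivative_coeff, HahnSeries.C_apply]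
  rcases eq_or_ne (n + 1) 0 with h | h
  · simp [h]
  · rw [coeff_single_of_ne h, mul_zero, coeff_zero]

theorem derivative_pow_succ (f : LaurentSeries K) (n : ℕ) :
    derivative K (f ^ (n + 1)) = HahnSeries.C (n + 1 : K) * f ^ n * derivative K f := by
  induction n with
  | zero => simp
  | succ n ih =>
    rw [pow_succ, derivative_mul, ih]
    simp only [map_add, map_natCast, map_one]
    push_cast
    ring

theorem derivative_eval₂ (f : LaurentSeries K) (p : Polynomial K) :
    derivative K (Polynomial.eval₂RingHom HahnSeries.C f p) =
      Polynomial.eval₂RingHom HahnSeries.C f (Polynomial.derivative p) * derivative K f := by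
  induction p using Polynomial.induction_on' with
  | add p q hp hq => simp only [map_add, hp, hq, add_mul]
  | monomial n a =>
    rw [Polynomial.derivative_monomial]
    simp only [Polynomial.coe_eval₂RingHom, Polynomial.eval₂_monomial]
    rw [derivative_C_mul]
    cases n with
    | zero => simpa using Or.inr (derivative_C (1 : K))
    | succ n =>
      rw [derivative_pow_succ, Nat.add_sub_cancel, map_mul]
      push_cast
      ring

theorem residue_derivative (f : LaurentSeries K) : (derivative K f).coeff (-1) = 0 := by
  rw [derivative_coeff]
  simp

end LaurentSeries

theorem Polynomial.exists_derivative_eq {K : Type*} [Field K] [CharZero K] (p : Polynomial K) :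
    ∃ q : Polynomial K, derivative q = p := by
  induction p using Polynomial.induction_on' with
  | add p q hp hq =>
    obtain ⟨a, rfl⟩ := hp
    obtain ⟨b, rfl⟩ := hq
    exact ⟨a + b, derivative_add⟩
  | monomial n a =>
    refine ⟨monomial (n + 1) (a / (n + 1)), ?_⟩
    have : (n + 1 : K) ≠ 0 := by exact_mod_cast n.succ_ne_zero
    rw [derivative_monomial]
    simp [div_mul_cancel₀ _ this]

/-! ### Odd derivatives of a solution of the Weierstrass equation. -/

namespace LaurentSeries

variable {K : Type*} [Field K]

theorem exists_derivative_iterate_eq_of_weierstrass [CharZero K] {P : LaurentSeries K} {a b : K}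
    (hP : derivative K P ≠ 0)
    (h : derivative K P ^ 2 = Polynomial.eval₂RingHom HahnSeries.C P
      (4 * Polynomial.X ^ 3 - Polynomial.C a * Polynomial.X - Polynomial.C b)) (j : ℕ) :
    ∃ A : Polynomial K,
      (derivative K)^[2 * j + 1] P = derivative K P * Polynomial.eval₂RingHom HahnSeries.C P A := by
  -- Differentiate the cubic equation, then cancel `P'` and the factor 2.
  have h2 : derivative K (derivative K P) =
      Polynomial.eval₂RingHom HahnSeries.C P (6 * Polynomial.X ^ 2 - Polynomial.C (a / 2)) := by
    have := congrArg (derivative K) h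
    rw [derivative_eval₂, pow_two, derivative_mul, ← two_mul, mul_left_comm, mul_comm] at this
    have h3 := mul_right_cancel₀ hP (this.trans rfl)
    have h4 : Polynomial.derivative
        (4 * Polynomial.X ^ 3 - Polynomial.C a * Polynomial.X - Polynomial.C b) =
        2 * (6 * Polynomial.X ^ 2 - Polynomial.C (a / 2)) := by
      have : Polynomial.C a = 2 * Polynomial.C (a / 2) := by
        rw [← Polynomial.C_ofNat, ← Polynomial.C_mul]
        congr 1
        field_simp
      rw [this]
      simp only [Polynomial.derivative_sub, Polynomial.derivative_mul,
        Polynomial.derivative_ofNat, Polynomial.derivative_X_pow, Polynomial.derivative_C,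
        Polynomial.derivative_X, map_ofNat, Nat.cast_ofNat]
      ring
    have h20 : (2 : LaurentSeries K) ≠ 0 := by
      rw [← map_ofNat (HahnSeries.C (Γ := ℤ) (R := K)) 2]
      exact HahnSeries.C_ne_zero two_ne_zero
    rw [h4, map_mul, map_ofNat] at h3
    exact mul_left_cancel₀ h20 h3
  induction j with
  | zero => exact ⟨1, by simp⟩
  | succ j ih =>
    obtain ⟨A, hA⟩ := ih
    -- `(P' A(P))' = P'' A(P) + P'² A'(P)` is a polynomial `B(P)`; one more derivative gives `P'
    -- B'(P)`.
    refine ⟨Polynomial.derivative ((6 * Polynomial.X ^ 2 - Polynomial.C (a / 2)) * A +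
      (4 * Polynomial.X ^ 3 - Polynomial.C a * Polynomial.X - Polynomial.C b) *
        Polynomial.derivative A), ?_⟩
    rw [show 2 * (j + 1) + 1 = (2 * j + 1) + 1 + 1 by ring, Function.iterate_succ_apply',
      Function.iterate_succ_apply', hA,
      mul_comm (derivative K P) (Polynomial.eval₂RingHom HahnSeries.C P (Polynomial.derivative _)),
      ← derivative_eval₂]
    congr 1
    rw [derivative_mul, derivative_eval₂, h2, map_add, map_mul, map_mul, ← h]
    ring

theorem residue_derivative_iterate_mul_of_weierstrass [CharZero K] {P : LaurentSeries K} {a b : K}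
    (hP : derivative K P ≠ 0)
    (h : derivative K P ^ 2 = Polynomial.eval₂RingHom HahnSeries.C P
      (4 * Polynomial.X ^ 3 - Polynomial.C a * Polynomial.X - Polynomial.C b)) (i j k : ℕ) :
    ((derivative K)^[2 * i + 1] P * (derivative K)^[2 * j + 1] P *
      (derivative K)^[2 * k + 1] P).coeff (-1) = 0 := by
  obtain ⟨A, hA⟩ := exists_derivative_iterate_eq_of_weierstrass hP h i
  obtain ⟨B, hB⟩ := exists_derivative_iterate_eq_of_weierstrass hP h j
  obtain ⟨C, hC⟩ := exists_derivative_iterate_eq_of_weierstrass hP h k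
  -- Two of the three factors `P'` are absorbed into the cubic; the third makes the product a
  -- chain-rule derivative.
  obtain ⟨S, hS⟩ := Polynomial.exists_derivative_eq
    ((4 * Polynomial.X ^ 3 - Polynomial.C a * Polynomial.X - Polynomial.C b) * A * B * C)
  have : (derivative K)^[2 * i + 1] P * (derivative K)^[2 * j + 1] P *
      (derivative K)^[2 * k + 1] P = derivative K (Polynomial.eval₂RingHom HahnSeries.C P S) := by
    rw [derivative_eval₂, hS, hA, hB, hC]
    simp only [map_mul]
    rw [← h]
    ring
  rw [this, residue_derivative]

/-! ### Regular parts of the odd derivatives and the residue of their product. -/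

/-- The power series `∑ (k+s choose s) g_{k+s+1} Xᵏ`: when `g` is the sequence of Eisenstein sums of a
lattice and `s` is even, it is the regular part at the origin of `-∑ (z - l)⁻ˢ⁻¹`. -/
noncomputable def latticeSumRegularPart (g : ℕ → K) (s : ℕ) : PowerSeries K :=
  PowerSeries.mk fun k => ((k + s).choose s : K) * g (k + s + 1)

/-- The constant term of `p` is left free because `m ≥ 1` derivatives kill it. Oddness of `m` gives
the minus sign on the pole. -/
theorem derivative_iterate_eq_latticeSum {g : ℕ → K} {p : PowerSeries K}
    (hp : ∀ k, 1 ≤ k → PowerSeries.coeff k p = (k + 1) * g (k + 2)) {m : ℕ} (hm : Odd m) :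
    (derivative K)^[m] (HahnSeries.single (-2 : ℤ) (1 : K) + HahnSeries.ofPowerSeries ℤ K p) =
      HahnSeries.C ((m + 1).factorial : K) *
        (HahnSeries.ofPowerSeries ℤ K (latticeSumRegularPart g (m + 1)) -
          HahnSeries.single (-(m + 2 : ℕ) : ℤ) (1 : K)) := by
  have hm0 : 1 ≤ m := hm.pos
  have h1 : hasseDeriv K m (HahnSeries.single (-2 : ℤ) (1 : K)) =
      HahnSeries.C (-(m + 1 : K)) * HahnSeries.single (-(m + 2 : ℕ) : ℤ) (1 : K) := by
    rw [hasseDeriv_single, Ring.choose_neg, Int.negOnePow_odd _ (by exact_mod_cast hm),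
      show (2 + (m : ℤ) - 1) = ((m + 1 : ℕ) : ℤ) by push_cast; ring, Ring.choose_natCast]
    rw [show (-2 - (m : ℤ)) = -((m + 2 : ℕ) : ℤ) by push_cast; ring]
    rw [HahnSeries.C_apply, HahnSeries.single_mul_single, zero_add]
    congr 1
    simp [add_comm]
  have h2 : hasseDeriv K m (HahnSeries.ofPowerSeries ℤ K p) =
      HahnSeries.C (m + 1 : K) * HahnSeries.ofPowerSeries ℤ K (latticeSumRegularPart g (m + 1)) := by
    ext n
    rw [hasseDeriv_coeff, coeff_C_mul]
    rcases le_or_gt 0 n with hn | hn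
    · lift n to ℕ using hn
      rw [← Nat.cast_add, Ring.choose_natCast, HahnSeries.ofPowerSeries_apply_coeff,
        HahnSeries.ofPowerSeries_apply_coeff, hp _ (by omega), latticeSumRegularPart,
        PowerSeries.coeff_mk]
      have := Nat.add_one_mul_choose_eq (n + m) m
      have h3 : ((n + m + 1 : K)) * ((n + m).choose m : K) =
        ((n + (m + 1)).choose (m + 1) : K) * (m + 1) := by
        rw [← add_assoc n m 1]
        simpa only [Nat.cast_mul, Nat.cast_add, Nat.cast_one] using congrArg (Nat.cast (R := K)) this
      rw [show n + (m + 1) + 1 = n + m + 2 by ring]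
      simp only [natCast_zsmul, nsmul_eq_mul]
      push_cast
      linear_combination g (n + m + 2) * h3
    · have h0 : ∀ (f : PowerSeries K) (i : ℤ), i < 0 →
          (HahnSeries.ofPowerSeries ℤ K f).coeff i = 0 := fun f i hi => by
        rw [PowerSeries.coeff_coe, if_pos hi]
      rw [h0 _ n hn, mul_zero]
      -- In negative degree `n`, either `0 ≤ n + m < m` and the binomial vanishes, or the
      -- coefficient of `p` does.
      rcases le_or_gt 0 (n + m) with h | h
      · rw [show n + (m : ℤ) = ((n + m).toNat : ℤ) by omega, Ring.choose_natCast,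
          Nat.choose_eq_zero_of_lt (by omega)]
        simp
      · rw [h0 _ _ h, smul_zero]
  rw [derivative_iterate, map_add, h1, h2, Nat.factorial_succ]
  rw [nsmul_eq_mul, ← map_natCast (HahnSeries.C (Γ := ℤ) (R := K))]
  simp only [map_neg, map_add, map_mul, map_natCast, map_one, Nat.cast_mul, Nat.cast_add,
    Nat.cast_one]
  ring

/-- Only mixed terms contribute: the product of the three power series has no polar part, and the
product of the three poles has order `2a + b > 1`. -/
theorem residue_sq_mul_eq (A B : PowerSeries K) {a b : ℕ} (ha : 1 ≤ a) (hb : 1 ≤ b) :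
    ((HahnSeries.ofPowerSeries ℤ K A - HahnSeries.single (-(a : ℕ) : ℤ) 1) *
      (HahnSeries.ofPowerSeries ℤ K A - HahnSeries.single (-(a : ℕ) : ℤ) 1) *
      (HahnSeries.ofPowerSeries ℤ K B - HahnSeries.single (-(b : ℕ) : ℤ) 1)).coeff (-1) =
    PowerSeries.coeff (2 * a - 1) B + 2 * PowerSeries.coeff (a + b - 1) A -
      PowerSeries.coeff (b - 1) (A * A) - 2 * PowerSeries.coeff (a - 1) (A * B) := by
  have key : ∀ (c : ℕ) (F : PowerSeries K), 1 ≤ c →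
      (HahnSeries.single (-(c : ℕ) : ℤ) (1 : K) * HahnSeries.ofPowerSeries ℤ K F).coeff (-1) =
        PowerSeries.coeff (c - 1) F := fun c F hc => by
    rw [HahnSeries.coeff_single_mul, one_mul,
      show (-1 - -(c : ℤ)) = ((c - 1 : ℕ) : ℤ) by omega, HahnSeries.ofPowerSeries_apply_coeff]
  have expand : (HahnSeries.ofPowerSeries ℤ K A - HahnSeries.single (-(a : ℕ) : ℤ) 1) *
      (HahnSeries.ofPowerSeries ℤ K A - HahnSeries.single (-(a : ℕ) : ℤ) 1) *
      (HahnSeries.ofPowerSeries ℤ K B - HahnSeries.single (-(b : ℕ) : ℤ) 1) =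
      HahnSeries.ofPowerSeries ℤ K (A * A * B)
      + HahnSeries.single (-(2 * a : ℕ) : ℤ) 1 * HahnSeries.ofPowerSeries ℤ K B
      + HahnSeries.single (-(a + b : ℕ) : ℤ) 1 * HahnSeries.ofPowerSeries ℤ K (2 * A)
      - HahnSeries.single (-(b : ℕ) : ℤ) 1 * HahnSeries.ofPowerSeries ℤ K (A * A)
      - HahnSeries.single (-(a : ℕ) : ℤ) 1 * HahnSeries.ofPowerSeries ℤ K (2 * (A * B))
      - HahnSeries.single (-(2 * a + b : ℕ) : ℤ) 1 := by
    have e1 : HahnSeries.single (-(2 * a : ℕ) : ℤ) (1 : K) =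
        HahnSeries.single (-(a : ℕ) : ℤ) 1 * HahnSeries.single (-(a : ℕ) : ℤ) 1 := by
      rw [HahnSeries.single_mul_single, one_mul]; congr 1; push_cast; ring_nf
    have e2 : HahnSeries.single (-(a + b : ℕ) : ℤ) (1 : K) =
        HahnSeries.single (-(a : ℕ) : ℤ) 1 * HahnSeries.single (-(b : ℕ) : ℤ) 1 := by
      rw [HahnSeries.single_mul_single, one_mul]; congr 1; push_cast; ring_nf
    have e3 : HahnSeries.single (-(2 * a + b : ℕ) : ℤ) (1 : K) =
        HahnSeries.single (-(a : ℕ) : ℤ) 1 * HahnSeries.single (-(a : ℕ) : ℤ) 1 *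
          HahnSeries.single (-(b : ℕ) : ℤ) 1 := by
      rw [HahnSeries.single_mul_single, HahnSeries.single_mul_single, one_mul, one_mul]
      congr 1; push_cast; ring_nf
    rw [e1, e2, e3]
    simp only [map_mul, map_ofNat]
    ring
  rw [expand]
  simp only [HahnSeries.coeff_add, HahnSeries.coeff_sub]
  rw [key _ _ (by omega), key _ _ (by omega), key _ _ hb, key _ _ ha,
    HahnSeries.coeff_single_of_ne (by omega), PowerSeries.coeff_coe, if_pos (by norm_num)]
  simp only [← map_ofNat (PowerSeries.C (R := K)) 2, PowerSeries.coeff_C_mul]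
  ring

end LaurentSeries


/-! ### Taylor expansion as a ring homomorphism on analytic germs. -/

/-- The Taylor series at the origin of a function of one complex variable. -/
noncomputable def taylorSeries (f : ℂ → ℂ) : PowerSeries ℂ :=
  PowerSeries.mk fun n => iteratedDeriv n f 0 / n.factorial

namespace taylorSeries

open Topology

theorem coeff_eq (f : ℂ → ℂ) (n : ℕ) :
    PowerSeries.coeff n (taylorSeries f) = iteratedDeriv n f 0 / n.factorial :=
  PowerSeries.coeff_mk _ _

theorem congr {f g : ℂ → ℂ} (h : f =ᶠ[𝓝 0] g) : taylorSeries f = taylorSeries g := by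
  ext n
  rw [coeff_eq, coeff_eq, h.iteratedDeriv_eq]

theorem add {f g : ℂ → ℂ} (hf : AnalyticAt ℂ f 0) (hg : AnalyticAt ℂ g 0) :
    taylorSeries (f + g) = taylorSeries f + taylorSeries g := by
  ext n
  rw [map_add, coeff_eq, coeff_eq, coeff_eq, iteratedDeriv_add hf.contDiffAt hg.contDiffAt, add_div]

theorem mul {f g : ℂ → ℂ} (hf : AnalyticAt ℂ f 0) (hg : AnalyticAt ℂ g 0) :
    taylorSeries (f * g) = taylorSeries f * taylorSeries g := by
  ext n
  rw [PowerSeries.coeff_mul, coeff_eq, iteratedDeriv_mul hf.contDiffAt hg.contDiffAt,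
    Finset.Nat.sum_antidiagonal_eq_sum_range_succ_mk, Finset.sum_div]
  refine Finset.sum_congr rfl fun i hi => ?_
  have hi' : i ≤ n := Nat.lt_succ_iff.mp (Finset.mem_range.mp hi)
  rw [coeff_eq, coeff_eq, Nat.cast_choose ℂ hi']
  have h (m : ℕ) : (m.factorial : ℂ) ≠ 0 := by exact_mod_cast m.factorial_ne_zero
  have h1 := h n
  have h2 := h i
  have h3 := h (n - i)
  field_simp

theorem pow {f : ℂ → ℂ} (hf : AnalyticAt ℂ f 0) (n : ℕ) :
    taylorSeries (f ^ n) = taylorSeries f ^ n := by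
  induction n with
  | zero =>
    ext n
    rw [coeff_eq, pow_zero, pow_zero, PowerSeries.coeff_one]
    change iteratedDeriv n (fun _ => (1 : ℂ)) 0 / _ = _
    rw [iteratedDeriv_const]
    split_ifs with h <;> simp [h]
  | succ n ih => rw [pow_succ, pow_succ, mul (hf.pow n) hf, ih]

theorem const (c : ℂ) : taylorSeries (Function.const ℂ c) = PowerSeries.C c := by
  ext n
  rw [coeff_eq, PowerSeries.coeff_C]
  change iteratedDeriv n (fun _ => c) 0 / _ = _
  rw [iteratedDeriv_const]
  split_ifs with h <;> simp [h]

theorem id : taylorSeries _root_.id = PowerSeries.X := by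
  ext n
  rw [coeff_eq, PowerSeries.coeff_X, iteratedDeriv_id]
  rcases n with _ | _ | n <;> simp

end taylorSeries

/-! ### The Laurent series of `℘` and its differential equation. -/

namespace PeriodPair

open Topology

variable (L : PeriodPair)

/-- The Taylor series at the origin of `℘(z) - z⁻²`. -/
noncomputable def weierstrassPRegular : PowerSeries ℂ :=
  taylorSeries (L.weierstrassPExcept 0)

/-- The Laurent series of `℘` at the origin. -/
noncomputable def weierstrassPLaurent : LaurentSeries ℂ :=
  HahnSeries.single (-2 : ℤ) (1 : ℂ) + HahnSeries.ofPowerSeries ℤ ℂ L.weierstrassPRegular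

theorem coeff_weierstrassPRegular (k : ℕ) (hk : 1 ≤ k) :
    PowerSeries.coeff k L.weierstrassPRegular = (k + 1) * L.G (k + 2) := by
  have := Nat.factorial_ne_zero k
  rw [weierstrassPRegular, taylorSeries.coeff_eq, iteratedDeriv_weierstrassPExcept_self,
    if_neg (by omega), sumInvPow_zero, Nat.factorial_succ]
  push_cast
  field_simp

/-- This is the differential equation multiplied by `z⁶`, which clears the poles: `z²℘` and `z³℘'`
are analytic at 0. There it reads `(-2)² - 4 = 0`. The use of sums, products and constant functions
only lets Taylor expansion be applied term by term. -/
theorem weierstrassP_relation_eventuallyEq_zero :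
    (L.derivWeierstrassPExcept 0 * id ^ 3 + Function.const ℂ (-2)) ^ 2 +
      Function.const ℂ (-4) * (L.weierstrassPExcept 0 * id ^ 2 + Function.const ℂ 1) ^ 3 +
      Function.const ℂ L.g₂ * (L.weierstrassPExcept 0 * id ^ 2 + Function.const ℂ 1) * id ^ 4 +
      Function.const ℂ L.g₃ * id ^ 6 =ᶠ[𝓝 0] Function.const ℂ 0 := by
  filter_upwards [L.compl_lattice_sdiff_singleton_mem_nhds 0] with z hz
  by_cases hz0 : z = 0
  · simp [hz0]; norm_num
  replace hz : z ∉ L.lattice := by simp_all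
  have h1 := L.weierstrassPExcept_def 0 z
  have h2 := L.derivWeierstrassPExcept_def 0 z
  have h3 := L.derivWeierstrassP_sq z hz
  simp only [ZeroMemClass.coe_zero] at h1 h2
  simp only [Pi.add_apply, Pi.mul_apply, Pi.pow_apply, Function.const_apply, _root_.id]
  have e1 : L.weierstrassPExcept 0 z * z ^ 2 + 1 = L.weierstrassP z * z ^ 2 := by
    rw [h1]; simp; field_simp; ring
  have e2 : L.derivWeierstrassPExcept 0 z * z ^ 3 + -2 = L.derivWeierstrassP z * z ^ 3 := by
    rw [h2]; simp; field_simp; ring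
  rw [e1, e2]
  linear_combination z ^ 6 * h3

theorem weierstrassPRegular_relation :
    (taylorSeries (L.derivWeierstrassPExcept 0) * PowerSeries.X ^ 3 + PowerSeries.C (-2)) ^ 2 +
      PowerSeries.C (-4) * (L.weierstrassPRegular * PowerSeries.X ^ 2 + PowerSeries.C 1) ^ 3 +
      PowerSeries.C L.g₂ * (L.weierstrassPRegular * PowerSeries.X ^ 2 + PowerSeries.C 1) *
        PowerSeries.X ^ 4 +
      PowerSeries.C L.g₃ * PowerSeries.X ^ 6 = 0 := by
  have h := taylorSeries.congr L.weierstrassP_relation_eventuallyEq_zero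
  have hP := L.analyticAt_weierstrassPExcept 0
  have hQ := L.analyticAt_derivWeierstrassPExcept 0
  have hX : AnalyticAt ℂ (id : ℂ → ℂ) 0 := analyticAt_id
  have hc : ∀ c : ℂ, AnalyticAt ℂ (Function.const ℂ c) 0 := fun c => analyticAt_const
  have hP2 := (hP.mul (hX.pow 2)).add (hc 1)
  have hQ2 := (hQ.mul (hX.pow 3)).add (hc (-2))
  have t1 := (hc (-4)).mul (hP2.pow 3)
  have t2 := ((hc L.g₂).mul hP2).mul (hX.pow 4)
  have t3 := (hc L.g₃).mul (hX.pow 6)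
  rwa [taylorSeries.add (((hQ2.pow 2).add t1).add t2) t3,
    taylorSeries.add ((hQ2.pow 2).add t1) t2, taylorSeries.add (hQ2.pow 2) t1,
    taylorSeries.pow hQ2, taylorSeries.add (hQ.mul (hX.pow 3)) (hc _),
    taylorSeries.mul hQ (hX.pow 3), taylorSeries.mul (hc _) (hP2.pow 3),
    taylorSeries.pow hP2, taylorSeries.mul ((hc _).mul hP2) (hX.pow 4),
    taylorSeries.mul (hc _) hP2, taylorSeries.add (hP.mul (hX.pow 2)) (hc _),
    taylorSeries.mul hP (hX.pow 2), taylorSeries.mul (hc _) (hX.pow 6),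
    taylorSeries.pow hX, taylorSeries.pow hX, taylorSeries.pow hX, taylorSeries.pow hX,
    taylorSeries.id, taylorSeries.const, taylorSeries.const, taylorSeries.const,
    taylorSeries.const, taylorSeries.const, taylorSeries.const, map_zero] at h

theorem derivative_weierstrassPLaurent :
    LaurentSeries.derivative ℂ L.weierstrassPLaurent = HahnSeries.single (-3 : ℤ) (-2 : ℂ) +
      HahnSeries.ofPowerSeries ℤ ℂ (taylorSeries (L.derivWeierstrassPExcept 0)) := by
  have h1 : LaurentSeries.derivative ℂ (HahnSeries.single (-2 : ℤ) (1 : ℂ)) =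
      HahnSeries.single (-3 : ℤ) (-2 : ℂ) := by
    rw [LaurentSeries.derivative_apply, LaurentSeries.hasseDeriv_single]
    simp
  rw [weierstrassPLaurent, map_add, h1]
  congr 1
  ext n
  rw [LaurentSeries.derivative_coeff]
  rcases le_or_gt 0 n with hn | hn
  · lift n to ℕ using hn
    rw [show (n : ℤ) + 1 = ((n + 1 : ℕ) : ℤ) by push_cast; ring,
      HahnSeries.ofPowerSeries_apply_coeff, HahnSeries.ofPowerSeries_apply_coeff,
      coeff_weierstrassPRegular _ _ (by omega), taylorSeries.coeff_eq,
      iteratedDeriv_derivWeierstrassPExcept_self, sumInvPow_zero, Nat.factorial_succ,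
      Nat.factorial_succ]
    have := Nat.factorial_ne_zero n
    push_cast
    field_simp
  · rw [PowerSeries.coeff_coe, PowerSeries.coeff_coe, if_pos hn]
    rcases eq_or_ne (n + 1) 0 with h | h
    · simp [h]
    · rw [if_pos (by omega), mul_zero]

theorem derivative_weierstrassPLaurent_ne_zero :
    LaurentSeries.derivative ℂ L.weierstrassPLaurent ≠ 0 := by
  intro h
  have := congrArg (fun f : LaurentSeries ℂ => f.coeff (-3)) h
  simp only [derivative_weierstrassPLaurent, HahnSeries.coeff_add, HahnSeries.coeff_single_same,
    HahnSeries.coeff_zero] at this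
  rw [PowerSeries.coeff_coe, if_pos (by norm_num)] at this
  norm_num at this

theorem derivative_weierstrassPLaurent_sq :
    LaurentSeries.derivative ℂ L.weierstrassPLaurent ^ 2 =
      Polynomial.eval₂RingHom HahnSeries.C L.weierstrassPLaurent
        (4 * Polynomial.X ^ 3 - Polynomial.C L.g₂ * Polynomial.X - Polynomial.C L.g₃) := by
  have hx : HahnSeries.single (1 : ℤ) (1 : ℂ) ≠ 0 := HahnSeries.single_ne_zero one_ne_zero
  set x : LaurentSeries ℂ := HahnSeries.single (1 : ℤ) (1 : ℂ) with hxdef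
  have h := congrArg (HahnSeries.ofPowerSeries ℤ ℂ) L.weierstrassPRegular_relation
  simp only [map_add, map_mul, map_pow, HahnSeries.ofPowerSeries_X, HahnSeries.ofPowerSeries_C,
    map_zero, map_neg, map_ofNat, map_one] at h
  rw [← hxdef] at h
  have hP : L.weierstrassPLaurent * x ^ 2 =
      HahnSeries.ofPowerSeries ℤ ℂ L.weierstrassPRegular * x ^ 2 + 1 := by
    have : HahnSeries.single (-2 : ℤ) (1 : ℂ) * x ^ 2 = 1 := by
      rw [hxdef, HahnSeries.single_pow, HahnSeries.single_mul_single]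
      simp
    rw [weierstrassPLaurent, add_mul, this, add_comm]
  have hQ : LaurentSeries.derivative ℂ L.weierstrassPLaurent * x ^ 3 =
      HahnSeries.ofPowerSeries ℤ ℂ (taylorSeries (L.derivWeierstrassPExcept 0)) * x ^ 3 + -2 := by
    have : HahnSeries.single (-3 : ℤ) (-2 : ℂ) * x ^ 3 = -2 := by
      rw [hxdef, HahnSeries.single_pow, HahnSeries.single_mul_single,
        ← map_ofNat (HahnSeries.C (Γ := ℤ) (R := ℂ)) 2, ← map_neg, HahnSeries.C_apply]
      congr 1
      simp
    rw [derivative_weierstrassPLaurent, add_mul, this, add_comm]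
  rw [← hP, ← hQ] at h
  refine mul_right_cancel₀ (pow_ne_zero 6 hx) ?_
  simp only [map_sub, map_mul, map_pow, map_ofNat, Polynomial.coe_eval₂RingHom,
    Polynomial.eval₂_X, Polynomial.eval₂_C]
  linear_combination h

end PeriodPair

/-! ### Eisenstein series as lattice sums. -/

namespace UpperHalfPlane

/-- The pair of periods `(τ, 1)`. -/
noncomputable def periodPair (τ : UpperHalfPlane) : PeriodPair where
  ω₁ := τ
  ω₂ := 1
  indep := by
    rw [LinearIndependent.pair_iff]
    intro s t h
    have him := congrArg Complex.im h
    have hre := congrArg Complex.re h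
    simp at him hre
    have hs : s = 0 := him.resolve_right τ.im_pos.ne'
    subst hs
    exact ⟨rfl, by simpa using hre⟩

theorem G_periodPair (τ : UpperHalfPlane) (k : ℕ) (hk : k ≠ 0) :
    τ.periodPair.G k = eisensteinG k τ := by
  rw [PeriodPair.G, eisensteinG, ← τ.periodPair.latticeEquivProd.symm.toEquiv.tsum_eq]
  -- `PeriodPair.G` sums over the whole lattice; for `k ≠ 0` the origin contributes `(0 ^ k)⁻¹ = 0`.
  have hsupp : Function.support (fun v : ℤ × ℤ =>
      ((τ.periodPair.latticeEquivProd.symm v : ℂ) ^ k)⁻¹) ⊆ {v | v ≠ (0, 0)} := by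
    rintro v hv rfl
    apply hv
    change ((τ.periodPair.latticeEquivProd.symm 0 : ℂ) ^ k)⁻¹ = 0
    simp [hk]
  refine (tsum_subtype_eq_of_support_subset hsupp).symm.trans (tsum_congr fun v => ?_)
  rw [PeriodPair.latticeEquiv_symm_apply, zpow_neg, zpow_natCast]
  simp [periodPair]

end UpperHalfPlane



/-! ### The convolution identity. -/

namespace PeriodPair

theorem G_convolution_of_choose (L : PeriodPair) (n : ℕ) (hn : 1 ≤ n) :
    (((6 * n + 3).choose (2 * n + 2) : ℂ) + 2 * ((6 * n + 3).choose (2 * n) : ℂ)) *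
        L.G (6 * n + 4) =
      PowerSeries.coeff (2 * n + 2) (LaurentSeries.latticeSumRegularPart L.G (2 * n) *
          LaurentSeries.latticeSumRegularPart L.G (2 * n)) +
        2 * PowerSeries.coeff (2 * n) (LaurentSeries.latticeSumRegularPart L.G (2 * n) *
          LaurentSeries.latticeSumRegularPart L.G (2 * n + 2)) := by
  have comb (a b : ℂ) (x y : LaurentSeries ℂ) :
      (HahnSeries.C a * x) * (HahnSeries.C a * x) * (HahnSeries.C b * y) =
        HahnSeries.C (a * a * b) * (x * x * y) := by
    rw [map_mul, map_mul]
    ring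
  -- The derivatives of orders `2n-1, 2n-1, 2n+1` have poles of orders `2n+1, 2n+1, 2n+3`.
  have hres := LaurentSeries.residue_derivative_iterate_mul_of_weierstrass
    L.derivative_weierstrassPLaurent_ne_zero L.derivative_weierstrassPLaurent_sq (n - 1) (n - 1) n
  rw [show 2 * (n - 1) + 1 = 2 * n - 1 by omega, weierstrassPLaurent,
    LaurentSeries.derivative_iterate_eq_latticeSum L.coeff_weierstrassPRegular
      (m := 2 * n - 1) ⟨n - 1, by omega⟩,
    LaurentSeries.derivative_iterate_eq_latticeSum L.coeff_weierstrassPRegular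
      (m := 2 * n + 1) ⟨n, rfl⟩, comb,
    LaurentSeries.coeff_C_mul] at hres
  have hfac (m : ℕ) : (m.factorial : ℂ) ≠ 0 := by exact_mod_cast m.factorial_ne_zero
  have hres := (mul_eq_zero.mp hres).resolve_left
    (mul_ne_zero (mul_ne_zero (hfac _) (hfac _)) (hfac _))
  rw [show 2 * n - 1 + 1 = 2 * n by omega, show 2 * n - 1 + 2 = 2 * n + 1 by omega,
    show 2 * n + 1 + 1 = 2 * n + 2 by ring, show 2 * n + 1 + 2 = 2 * n + 3 by ring,
    LaurentSeries.residue_sq_mul_eq _ _ (by omega) (by omega),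
    show 2 * (2 * n + 1) - 1 = 4 * n + 1 by omega,
    show 2 * n + 1 + (2 * n + 3) - 1 = 4 * n + 3 by omega,
    show 2 * n + 3 - 1 = 2 * n + 2 by omega, show 2 * n + 1 - 1 = 2 * n by omega] at hres
  have h1 : PowerSeries.coeff (4 * n + 1) (LaurentSeries.latticeSumRegularPart L.G (2 * n + 2)) =
      ((6 * n + 3).choose (2 * n + 2) : ℂ) * L.G (6 * n + 4) := by
    rw [LaurentSeries.latticeSumRegularPart, PowerSeries.coeff_mk,
      show 4 * n + 1 + (2 * n + 2) = 6 * n + 3 by ring]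
  have h2 : PowerSeries.coeff (4 * n + 3) (LaurentSeries.latticeSumRegularPart L.G (2 * n)) =
      ((6 * n + 3).choose (2 * n) : ℂ) * L.G (6 * n + 4) := by
    rw [LaurentSeries.latticeSumRegularPart, PowerSeries.coeff_mk,
      show 4 * n + 3 + 2 * n = 6 * n + 3 by ring]
  rw [h1, h2] at hres
  linear_combination hres

/-- For even `s`, the even-index coefficients of the first factor involve `G` of odd weight, which
is zero. Only the indices `2k - 1` survive. -/
theorem coeff_latticeSumRegularPart_mul (L : PeriodPair) {s t : ℕ} (hs : Even s) (N : ℕ) :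
    PowerSeries.coeff (2 * N) (LaurentSeries.latticeSumRegularPart L.G s *
        LaurentSeries.latticeSumRegularPart L.G t) =
      ∑ k ∈ Finset.Icc 1 N,
        ((s + 2 * k - 1).choose s * L.G (s + 2 * k)) *
          ((2 * N + 1 + t - 2 * k).choose t * L.G (2 * N + 2 + t - 2 * k)) := by
  rw [PowerSeries.coeff_mul, Finset.Nat.sum_antidiagonal_eq_sum_range_succ_mk]
  symm
  refine Finset.sum_of_injOn (fun k => 2 * k - 1) ?_ ?_ ?_ ?_
  · intro a ha b hb hab
    simp only [Finset.coe_Icc, Set.mem_Icc] at ha hb hab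
    omega
  · intro k hk
    simp only [Finset.coe_Icc, Set.mem_Icc, Finset.coe_range, Set.mem_Iio] at hk ⊢
    omega
  · intro i hi hni
    have hi' : i < 2 * N + 1 := by simpa using hi
    have heven : Even i := by
      by_contra hodd
      obtain ⟨j, rfl⟩ := Nat.not_even_iff_odd.mp hodd
      exact hni ⟨j + 1, by simp; omega, by simp; omega⟩
    rw [LaurentSeries.latticeSumRegularPart, PowerSeries.coeff_mk,
      L.G_eq_zero_of_odd _ (heven.add hs).add_one, mul_zero, zero_mul]
  · intro k hk
    rw [Finset.mem_Icc] at hk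
    rw [LaurentSeries.latticeSumRegularPart, LaurentSeries.latticeSumRegularPart,
      PowerSeries.coeff_mk, PowerSeries.coeff_mk, show 2 * k - 1 + s = s + 2 * k - 1 by omega,
      show s + 2 * k - 1 + 1 = s + 2 * k by omega,
      show 2 * N - (2 * k - 1) + t = 2 * N + 1 + t - 2 * k by omega,
      show 2 * N + 1 + t - 2 * k + 1 = 2 * N + 2 + t - 2 * k by omega]

end PeriodPair

theorem theorem1p3 (n : ℕ) (hn : 1 ≤ n) (τ : UpperHalfPlane) :
    (((6 * n + 3).choose (2 * n + 2) : ℂ) + 2 * ((6 * n + 3).choose (2 * n) : ℂ)) *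
        eisensteinG (6 * n + 4) τ =
      ∑ k ∈ Finset.Icc 1 (n + 1),
        (((2 * n + 2 * k - 1).choose (2 * n) : ℂ) * ((4 * n + 3 - 2 * k).choose (2 * n) : ℂ) +
          2 * ((2 * n + 2 * k - 1).choose (2 * n) : ℂ) *
            ((4 * n + 3 - 2 * k).choose (2 * n + 2) : ℂ)) *
        (eisensteinG (2 * n + 2 * k) τ * eisensteinG (4 * n + 4 - 2 * k) τ) := by
  have hG (k : ℕ) (hk : k ≠ 0) := (τ.G_periodPair k hk).symm
  have hsplit : ∑ k ∈ Finset.Icc 1 n,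
      ((2 * n + 2 * k - 1).choose (2 * n) * τ.periodPair.G (2 * n + 2 * k)) *
        ((2 * n + 1 + (2 * n + 2) - 2 * k).choose (2 * n + 2) *
          τ.periodPair.G (2 * n + 2 + (2 * n + 2) - 2 * k)) =
      ∑ k ∈ Finset.Icc 1 (n + 1),
      ((2 * n + 2 * k - 1).choose (2 * n) * τ.periodPair.G (2 * n + 2 * k)) *
        ((2 * n + 1 + (2 * n + 2) - 2 * k).choose (2 * n + 2) *
          τ.periodPair.G (2 * n + 2 + (2 * n + 2) - 2 * k)) := by
    -- The two convolutions have `n` and `n + 1` terms; the extra term at `k = n + 1` carries the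
    -- binomial `(2n+1 choose 2n+2) = 0`.
    rw [Finset.sum_Icc_succ_top (by omega), Nat.choose_eq_zero_of_lt
      (show 2 * n + 1 + (2 * n + 2) - 2 * (n + 1) < 2 * n + 2 by omega)]
    simp
  rw [hG _ (by omega), τ.periodPair.G_convolution_of_choose n hn,
    show 2 * n + 2 = 2 * (n + 1) by ring,
    τ.periodPair.coeff_latticeSumRegularPart_mul (even_two_mul n),
    ← show 2 * n + 2 = 2 * (n + 1) by ring,
    τ.periodPair.coeff_latticeSumRegularPart_mul (even_two_mul n), hsplit, Finset.mul_sum,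
    ← Finset.sum_add_distrib]
  refine Finset.sum_congr rfl fun k hk => ?_
  rw [Finset.mem_Icc] at hk
  rw [hG _ (by omega), hG _ (by omega),
    show 2 * n + 2 + 1 + 2 * n - 2 * k = 4 * n + 3 - 2 * k by omega,
    show 2 * n + 2 + 2 + 2 * n - 2 * k = 4 * n + 4 - 2 * k by omega,
    show 2 * n + 1 + (2 * n + 2) - 2 * k = 4 * n + 3 - 2 * k by omega,
    show 2 * n + 2 + (2 * n + 2) - 2 * k = 4 * n + 4 - 2 * k by omega]
  ring
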